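/- Let $\mathbb{F}$ be a finite field and $E$ a finite-dimensional $\mathbb{F}$-vector space with $\dim E\ge 2$; write $\mathcal L(E)$ for the set of subspaces of $E$. A $q$-matroid on $E$ is a pair $\mathcal M=(E,\rho)$ with $\rho:\mathcal L(E)\to\mathbb{N}_{\ge 0}$ such that for all $V,W\in\mathcal L(E)$: $0\le\rho(V)\le\dim V$; $V\le W$ implies $\rho(V)\le\rho(W)$; and $\rho(V+W)+\rho(V\cap W)\le\rho(V)+\rho(W)$. For $V\in\mathcal L(E)$ let $\mathrm{cl}(V)=\sum_{x\in E,\ \rho(V+\langle x\rangle)=\rho(V)}\langle x\rangle$, and let $\mathrm{cyc}(V)$ be the subspace of all $x\in V$ such that $\rho(W)=\rho(V)$ for all $W\le V$ with $W+\langle x\rangle=V$. A subspace $V$ is a flat if $\rho(V+\langle x\rangle)>\rho(V)$ for all $x\in E\setminus V$, and cyclic if $\mathrm{cyc}(V)=V$; $\mathcal Z(\mathcal M)$ denotes the collection of cyclic flats, that is, of flats that are also cyclic. $\mathcal M$ is full if $\mathrm{cl}(0)=0$ and $\mathrm{cyc}(E)=E$. If $E=E_1\oplus E_2$ with projections $\pi_i:E\to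 E_i$, and $\mathcal M_i=(E_i,\rho_i)$ are $q$-matroids, their direct sum $\mathcal M_1\oplus\mathcal M_2$ is the $q$-matroid on $E$ with rank function $$V\longmapsto \dim V+\min_{X\le V}\bigl(\rho_1(\pi_1(X))+\rho_2(\pi_2(X))-\dim X\bigr).$$ $\mathcal M$ is reducible if $\mathcal M=\mathcal M_1\oplus\mathcal M_2$ for some decomposition $E=E_1\oplus E_2$ with $E_1\neq0\neq E_2$ and some $q$-matroids $\mathcal M_i$ on $E_i$; otherwise it is irreducible. **Theorem.** Let $\mathcal M=(E,\rho)$ be a $q$-matroid with $\dim E\ge2$. The following are equivalent. (i) $\mathcal M$ is irreducible. (ii) $\mathcal M$ is full and there exist no nonzero spaces $Z_1,Z_2\in\mathcal Z(\mathcal M)$ such that $$Z_1\oplus Z_2=E,\qquad \rho(Z_1)+\rho(Z_2)=\rho(E),\qquad\text{and}\qquad \mathcal Z_1\oplus\mathcal Z_2=\mathcal Z(\mathcal M),$$ where $\mathcal Z_i=\{Z\in\mathcal Z(\mathcal M)\mid Z\le Z_i\}$ and $\mathcal Z_1\oplus\mathcal Z_2=\{Y_1\oplus Y_2\mid Y_i\in\mathcal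 Z_i\}$. -/

import Mathlib

/-- A `q`-matroid with ground space `E`: a rank function on the subspaces of `E` satisfying
(R1) dimension-boundedness, (R2) monotonicity and (R3) submodularity. -/
@[ext]
structure QMatroid (F E : Type*) [Field F] [AddCommGroup E] [Module F E] where
  /-- the rank function -/
  rank : Submodule F E → ℕ
  rank_le_finrank : ∀ V : Submodule F E, rank V ≤ Module.finrank F V
  rank_mono : ∀ V W : Submodule F E, V ≤ W → rank V ≤ rank W
  rank_submodular : ∀ V W : Submodule F E, rank (V ⊔ W) + rank (V ⊓ W) ≤ rank V + rank W

namespace QMatroid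

/-- The closure of `V`: the sum of all `⟨x⟩` with `ρ(V + ⟨x⟩) = ρ(V)`. -/
def closure {F E : Type*} [Field F] [AddCommGroup E] [Module F E] (M : QMatroid F E)
    (V : Submodule F E) : Submodule F E :=
  ⨆ (x : E) (_ : M.rank (V ⊔ Submodule.span F {x}) = M.rank V), Submodule.span F {x}

/-- The cyclic core of `V`: all `x ∈ V` such that `ρ(W) = ρ(V)` for every `W ≤ V` with
`W + ⟨x⟩ = V`. -/
def cyclicCore {F E : Type*} [Field F] [AddCommGroup E] [Module F E] (M : QMatroid F E)
    (V : Submodule F E) : Submodule F E where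
  carrier := {x | x ∈ V ∧ ∀ W : Submodule F E, W ≤ V → W ⊔ Submodule.span F {x} = V →
    M.rank W = M.rank V}
  zero_mem' := by
    refine ⟨V.zero_mem, fun W _ hW => ?_⟩
    rw [Submodule.span_zero_singleton, sup_bot_eq] at hW
    rw [hW]
  add_mem' := by
    rintro x y ⟨hxV, hx⟩ ⟨hyV, hy⟩
    refine ⟨V.add_mem hxV hyV, fun W hWV hW => ?_⟩
    have key : ∀ z ∈ V, z ∉ W → x + y ∉ W → W ⊔ Submodule.span F {z} = V := by
      intro z hzV hzW hxy
      have hcov : W ⋖ V := by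
        have h := Submodule.covBy_span_singleton_sup (K := F) hxy
        rwa [sup_comm, hW] at h
      have hle : W ⊔ Submodule.span F {z} ≤ V :=
        sup_le hWV ((Submodule.span_singleton_le_iff_mem z V).2 hzV)
      rcases hcov.eq_or_eq le_sup_left hle with h | h
      · exact absurd (h ▸ (le_sup_right : _ ≤ W ⊔ Submodule.span F {z})
          (Submodule.mem_span_singleton_self z)) hzW
      · exact h
    by_cases hxy : x + y ∈ W
    · rw [sup_eq_left.2 ((Submodule.span_singleton_le_iff_mem _ _).2 hxy)] at hW
      rw [hW]
    · by_cases hxW : x ∈ W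
      · have hyW : y ∉ W := fun h => hxy (W.add_mem hxW h)
        exact hy W hWV (key y hyV hyW hxy)
      · exact hx W hWV (key x hxV hxW hxy)
  smul_mem' := by
    rintro c x ⟨hxV, hx⟩
    refine ⟨V.smul_mem c hxV, fun W hWV hW => ?_⟩
    rcases eq_or_ne c 0 with rfl | hc
    · rw [zero_smul, Submodule.span_zero_singleton, sup_bot_eq] at hW
      rw [hW]
    · rw [Submodule.span_singleton_smul_eq (IsUnit.mk0 c hc)] at hW
      exact hx W hWV hW

/-- `V` is a flat: adding any vector outside `V` increases the rank. -/
def IsFlat {F E : Type*} [Field F] [AddCommGroup E] [Module F E] (M : QMatroid F E)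
    (V : Submodule F E) : Prop :=
  ∀ x : E, x ∉ V → M.rank V < M.rank (V ⊔ Submodule.span F {x})

/-- `V` is cyclic: it coincides with its cyclic core. -/
def IsCyclic {F E : Type*} [Field F] [AddCommGroup E] [Module F E] (M : QMatroid F E)
    (V : Submodule F E) : Prop :=
  M.cyclicCore V = V

/-- The collection of cyclic flats. -/
def cyclicFlats {F E : Type*} [Field F] [AddCommGroup E] [Module F E] (M : QMatroid F E) :
    Set (Submodule F E) :=
  {Z | M.IsFlat Z ∧ M.IsCyclic Z}

/-- `M` is full: the closure of `0` is `0` and the cyclic core of the ground space is the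
whole ground space. -/
def IsFull {F E : Type*} [Field F] [AddCommGroup E] [Module F E] (M : QMatroid F E) : Prop :=
  M.closure ⊥ = ⊥ ∧ M.cyclicCore ⊤ = ⊤

/-- The `q`-matroid `V ↦ ρ(f(V))` obtained from `M` and a linear map `f` into its ground space. -/
def comap {F E E' : Type*} [Field F] [AddCommGroup E] [Module F E] [AddCommGroup E']
    [Module F E'] [FiniteDimensional F E] (M : QMatroid F E') (f : E →ₗ[F] E') :
    QMatroid F E where
  rank V := M.rank (V.map f)
  rank_le_finrank V := (M.rank_le_finrank _).trans (Submodule.finrank_map_le f V)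
  rank_mono V W h := M.rank_mono _ _ (Submodule.map_mono h)
  rank_submodular V W := by
    have h1 : M.rank ((V ⊓ W).map f) ≤ M.rank (V.map f ⊓ W.map f) :=
      M.rank_mono _ _ (le_inf (Submodule.map_mono inf_le_left) (Submodule.map_mono inf_le_right))
    have h2 := M.rank_submodular (V.map f) (W.map f)
    rw [Submodule.map_sup]
    omega

/-- The union of two `q`-matroids on `E`, with rank function
`ρ(V) = dim V + min {ρ₁(X) + ρ₂(X) - dim X | X ≤ V}`. (As `X ≤ V`, the subtraction of natural
numbers below is not truncated, and the infimum of natural numbers over the nonempty set of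
all `X ≤ V` is a minimum.) -/
noncomputable def union {F E : Type*} [Field F] [AddCommGroup E] [Module F E]
    [FiniteDimensional F E] (M₁ M₂ : QMatroid F E) : QMatroid F E where
  rank V := ⨅ X : {X : Submodule F E // X ≤ V}, (M₁.rank X + M₂.rank X +
    (Module.finrank F V - Module.finrank F (X : Submodule F E)))
  rank_le_finrank V := by
    refine (ciInf_le (OrderBot.bddBelow _) (⟨⊥, bot_le⟩ : {X : Submodule F E // X ≤ V})).trans ?_
    have h1 := M₁.rank_le_finrank ⊥
    have h2 := M₂.rank_le_finrank ⊥
    simp only [finrank_bot] at h1 h2 ⊢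
    omega
  rank_mono V W hVW := by
    have : Nonempty {X : Submodule F E // X ≤ W} := ⟨⟨⊥, bot_le⟩⟩
    refine le_ciInf fun X => ?_
    obtain ⟨X, hX : X ≤ W⟩ := X
    refine (ciInf_le (OrderBot.bddBelow _)
      (⟨X ⊓ V, inf_le_right⟩ : {X : Submodule F E // X ≤ V})).trans ?_
    have h1 := M₁.rank_mono (X ⊓ V) X inf_le_left
    have h2 := M₂.rank_mono (X ⊓ V) X inf_le_left
    have h3 := Submodule.finrank_sup_add_finrank_inf_eq X V
    have h4 := Submodule.finrank_mono (sup_le hX hVW)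
    have h5 := Submodule.finrank_mono hX
    simp only
    omega
  rank_submodular V W := by
    have : Nonempty {X : Submodule F E // X ≤ V} := ⟨⟨⊥, bot_le⟩⟩
    have : Nonempty {X : Submodule F E // X ≤ W} := ⟨⟨⊥, bot_le⟩⟩
    obtain ⟨⟨X, hX : X ≤ V⟩, hXe⟩ := ciInf_mem fun X : {X : Submodule F E // X ≤ V} =>
      (M₁.rank X + M₂.rank X +
      (Module.finrank F V - Module.finrank F (X : Submodule F E)))
    obtain ⟨⟨Y, hY : Y ≤ W⟩, hYe⟩ := ciInf_mem fun X : {X : Submodule F E // X ≤ W} =>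
      (M₁.rank X + M₂.rank X +
      (Module.finrank F W - Module.finrank F (X : Submodule F E)))
    rw [← hXe, ← hYe]
    refine (add_le_add
      (ciInf_le (OrderBot.bddBelow _)
        (⟨X ⊔ Y, sup_le_sup hX hY⟩ : {X : Submodule F E // X ≤ V ⊔ W}))
      (ciInf_le (OrderBot.bddBelow _)
        (⟨X ⊓ Y, inf_le_inf hX hY⟩ : {X : Submodule F E // X ≤ V ⊓ W}))).trans ?_
    have h1 := M₁.rank_submodular X Y
    have h2 := M₂.rank_submodular X Y
    have h3 := Submodule.finrank_sup_add_finrank_inf_eq X Y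
    have h4 := Submodule.finrank_sup_add_finrank_inf_eq V W
    have h5 := Submodule.finrank_mono hX
    have h6 := Submodule.finrank_mono hY
    have h7 := Submodule.finrank_mono (sup_le_sup hX hY)
    have h8 := Submodule.finrank_mono (inf_le_inf hX hY)
    simp only
    omega

/-- The direct sum `M₁ ⊕ M₂` on `E = E₁ ⊕ E₂`: the union of the `q`-matroids on `E` with rank
functions `V ↦ ρᵢ(πᵢ(V))`, where `πᵢ : E → Eᵢ` are the projections. -/
noncomputable def directSum {F E : Type*} [Field F] [AddCommGroup E] [Module F E]
    [FiniteDimensional F E] {E₁ E₂ : Submodule F E} (h : IsCompl E₁ E₂)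
    (M₁ : QMatroid F E₁) (M₂ : QMatroid F E₂) : QMatroid F E :=
  (M₁.comap (Submodule.projectionOnto E₁ E₂ h)).union
    (M₂.comap (Submodule.projectionOnto E₂ E₁ h.symm))

/-- `M` is reducible: it is a direct sum of two `q`-matroids with nonzero ground spaces. -/
def IsReducible {F E : Type*} [Field F] [AddCommGroup E] [Module F E] [FiniteDimensional F E]
    (M : QMatroid F E) : Prop :=
  ∃ (E₁ E₂ : Submodule F E) (h : IsCompl E₁ E₂) (M₁ : QMatroid F E₁) (M₂ : QMatroid F E₂),
    E₁ ≠ ⊥ ∧ E₂ ≠ ⊥ ∧ M = directSum h M₁ M₂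

/-- `M` is irreducible: it is not reducible. -/
def IsIrreducible {F E : Type*} [Field F] [AddCommGroup E] [Module F E] [FiniteDimensional F E]
    (M : QMatroid F E) : Prop :=
  ¬ M.IsReducible

end QMatroid

/-! ### Projections along a direct decomposition. -/

section Projection

variable {F E : Type*} [Field F] [AddCommGroup E] [Module F E] {p q : Submodule F E}

/-! A direct sum restricts to its summands on `E₁` and `E₂`, so reducibility concerns only the rank
ρ of `M` and a decomposition. Submodularity always puts ρ below the rank of the direct sum of the
restrictions. What remains is the splitting inequality of `isReducible_iff`: each `V` contains an
`X` with ρ(π₁X) + ρ(π₂X) + dim V ≤ ρ(V) + dim X.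

If `M` is not full, a vector of rank 0 or a hyperplane of smaller rank splits off a line. If the
cyclic flats split along `Z₁`, `Z₂`, the inequality holds because they control the rank: some cyclic
flat `Y` satisfies ρ(Y) + dim V ≤ ρ(V) + dim(V ∩ Y), and X = V ∩ Y works.

Conversely, splitting makes ρ additive across `E₁`, `E₂`. Flatness and cyclicity then force each
cyclic flat to be the sum of its projections. Fullness makes these projections, and `E₁`, `E₂`
themselves, cyclic flats, while splitting makes sums of cyclic flats flat. -/

theorem Submodule.map_projection_le (h : IsCompl p q) (V : Submodule F E) :
    V.map (p.projection q h) ≤ p := by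
  rintro _ ⟨x, -, rfl⟩
  simp

theorem Submodule.map_projection_of_le_left (h : IsCompl p q) {V : Submodule F E} (hV : V ≤ p) :
    V.map (p.projection q h) = V := by
  have key : ∀ x ∈ V, p.projection q h x = x := fun x hx => by
    rw [← coe_projectionOnto_apply, projectionOnto_apply_of_mem_left h (hV hx)]
  ext x
  constructor
  · rintro ⟨y, hy, rfl⟩
    rwa [key y hy]
  · exact fun hx => ⟨x, hx, key x hx⟩

theorem Submodule.map_projection_of_le_right (h : IsCompl p q) {V : Submodule F E} (hV : V ≤ q) :
    V.map (p.projection q h) = ⊥ := by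
  rw [eq_bot_iff]
  rintro _ ⟨x, hx, rfl⟩
  rw [Submodule.mem_bot, ← coe_projectionOnto_apply,
    projectionOnto_apply_of_mem_right h (hV hx), Submodule.coe_zero]

theorem Submodule.projection_add_projection (h : IsCompl p q) (x : E) :
    p.projection q h x + q.projection p h.symm x = x := by
  have hx : x ∈ p ⊔ q := h.sup_eq_top ▸ Submodule.mem_top
  obtain ⟨y, hy, z, hz, rfl⟩ := Submodule.mem_sup.1 hx
  simp only [map_add, ← coe_projectionOnto_apply]
  rw [projectionOnto_apply_of_mem_left h hy, projectionOnto_apply_of_mem_right h hz,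
    projectionOnto_apply_of_mem_left h.symm hz, projectionOnto_apply_of_mem_right h.symm hy]
  simp

theorem Submodule.le_map_projection_sup (h : IsCompl p q) (V : Submodule F E) :
    V ≤ V.map (p.projection q h) ⊔ V.map (q.projection p h.symm) := by
  intro x hx
  rw [← projection_add_projection h x]
  exact Submodule.add_mem_sup (Submodule.mem_map_of_mem hx) (Submodule.mem_map_of_mem hx)

theorem Submodule.map_projection_sup_of_le (h : IsCompl p q) {V W : Submodule F E} (hV : V ≤ p)
    (hW : W ≤ q) : (V ⊔ W).map (p.projection q h) = V := by
  rw [Submodule.map_sup, map_projection_of_le_left h hV, map_projection_of_le_right h hW,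
    sup_bot_eq]

theorem Submodule.map_projection_le_sup (h : IsCompl p q) (V : Submodule F E) :
    V.map (p.projection q h) ≤ V ⊔ q := by
  rintro _ ⟨x, hx, rfl⟩
  rw [eq_sub_of_add_eq (projection_add_projection h x)]
  exact sub_mem (Submodule.mem_sup_left hx) (Submodule.mem_sup_right (by simp))

end Projection

/-! ### Cyclic spaces, flats and additivity of the rank. -/

namespace QMatroid

variable {F E : Type*} [Field F] [AddCommGroup E] [Module F E]

theorem rank_bot (M : QMatroid F E) : M.rank ⊥ = 0 := by
  simpa using M.rank_le_finrank ⊥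

theorem isCyclic_iff (M : QMatroid F E) {V : Submodule F E} :
    M.IsCyclic V ↔ ∀ W, W ⋖ V → M.rank W = M.rank V := by
  constructor
  · intro h W hW
    obtain ⟨x, hxV, hxW⟩ := SetLike.exists_of_lt hW.lt
    have hx : x ∈ M.cyclicCore V := by rwa [show M.cyclicCore V = V from h]
    refine hx.2 W hW.le ?_
    refine (hW.eq_or_eq le_sup_left
      (sup_le hW.le ((Submodule.span_singleton_le_iff_mem x V).2 hxV))).resolve_left fun h' => ?_
    exact hxW (h' ▸ (le_sup_right : _ ≤ W ⊔ Submodule.span F {x})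
      (Submodule.mem_span_singleton_self x))
  · intro h
    refine le_antisymm (fun x hx => hx.1) fun x hx => ⟨hx, fun W hWV hW => ?_⟩
    have hcov := Submodule.wcovBy_span_singleton_sup (K := F) x W
    rw [sup_comm, hW] at hcov
    rcases hcov.covBy_or_eq with h' | h'
    · exact h W h'
    · rw [h']

/-- `W ⊓ X` is a hyperplane of the cyclic space `X`, so it has the rank of `X`; submodularity
carries this up to `W` and `V`. -/
theorem IsCyclic.rank_eq_of_covBy {M : QMatroid F E} {X V W : Submodule F E} (hX : M.IsCyclic X)
    (hXV : X ≤ V) (hW : W ⋖ V) (hXW : ¬ X ≤ W) : M.rank W = M.rank V := by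
  have hsup : W ⊔ X = V := (hW.eq_or_eq le_sup_left (sup_le hW.le hXV)).resolve_left
    fun h => hXW (h ▸ le_sup_right)
  have hcov : W ⊓ X ⋖ X := by
    refine inf_covBy_of_covBy_sup_left ?_
    rwa [hsup]
  have h1 := M.isCyclic_iff.1 hX _ hcov
  have h2 := M.rank_submodular W X
  rw [hsup] at h2
  exact le_antisymm (M.rank_mono _ _ hW.le) (by omega)

theorem IsCyclic.sup {M : QMatroid F E} {V W : Submodule F E} (hV : M.IsCyclic V)
    (hW : M.IsCyclic W) : M.IsCyclic (V ⊔ W) := by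
  refine M.isCyclic_iff.2 fun U hU => ?_
  by_cases h : V ≤ U
  · exact hW.rank_eq_of_covBy le_sup_right hU fun h' => hU.lt.not_ge (sup_le h h')
  · exact hV.rank_eq_of_covBy le_sup_left hU h

theorem IsFlat.rank_lt {M : QMatroid F E} {V W : Submodule F E} (hV : M.IsFlat V) (h : V < W) :
    M.rank V < M.rank W := by
  obtain ⟨x, hxW, hxV⟩ := SetLike.exists_of_lt h
  exact (hV x hxV).trans_le
    (M.rank_mono _ _ (sup_le h.le ((Submodule.span_singleton_le_iff_mem x W).2 hxW)))

theorem closure_bot_eq_bot_iff (M : QMatroid F E) : M.closure ⊥ = ⊥ ↔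
    ∀ x, M.rank (Submodule.span F {x}) = 0 → x = 0 := by
  simp only [closure, bot_sup_eq, rank_bot, iSup_eq_bot, Submodule.span_singleton_eq_bot]

/-- Additivity descends from the whole space: submodularity for `Y₁ ⊔ Z₂` and `Z₁`, which meet in
`Y₁`, and then for `Y₁ ⊔ Y₂` and `Z₂`, which meet in `Y₂`. -/
theorem rank_sup_of_isCompl (M : QMatroid F E) {Z₁ Z₂ Y₁ Y₂ : Submodule F E}
    (h : IsCompl Z₁ Z₂) (hr : M.rank Z₁ + M.rank Z₂ = M.rank ⊤) (h₁ : Y₁ ≤ Z₁) (h₂ : Y₂ ≤ Z₂) :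
    M.rank (Y₁ ⊔ Y₂) = M.rank Y₁ + M.rank Y₂ := by
  have a1 := M.rank_submodular (Y₁ ⊔ Z₂) Z₁
  have a2 := M.rank_submodular (Y₁ ⊔ Y₂) Z₂
  have a3 := M.rank_submodular Y₁ Y₂
  rw [sup_inf_assoc_of_le _ h₁, h.symm.inf_eq_bot, sup_bot_eq, sup_assoc, h.symm.sup_eq_top,
    sup_top_eq] at a1
  rw [sup_comm Y₁ Y₂, sup_inf_assoc_of_le _ h₂, (h.disjoint.mono_left h₁).eq_bot, sup_bot_eq,
    sup_comm Y₂, sup_assoc, sup_eq_right.2 h₂] at a2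
  omega

theorem IsFull.top_mem_cyclicFlats {M : QMatroid F E} (hM : M.IsFull) : ⊤ ∈ M.cyclicFlats :=
  ⟨fun _ hx => absurd Submodule.mem_top hx, hM.2⟩

theorem map_subtype_map_projectionOnto {E₁ E₂ : Submodule F E} (h : IsCompl E₁ E₂)
    (X : Submodule F E) :
    (X.map (E₁.projectionOnto E₂ h)).map E₁.subtype = X.map (E₁.projection E₂ h) := by
  rw [← Submodule.map_comp]
  rfl

/-! ### Nullity, and how cyclic flats control the rank. -/

variable [FiniteDimensional F E]

theorem rank_le_add_of_le (M : QMatroid F E) {X V : Submodule F E} (h : X ≤ V) :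
    M.rank V + Module.finrank F X ≤ M.rank X + Module.finrank F V := by
  obtain ⟨C, hd, rfl⟩ := IsModularLattice.exists_disjoint_and_sup_eq h
  have h1 := M.rank_submodular X C
  have h2 := M.rank_le_finrank C
  have h3 := Submodule.finrank_sup_add_finrank_inf_eq X C
  rw [hd.eq_bot, finrank_bot] at h3
  omega

theorem finrank_covBy {V W : Submodule F E} (h : W ⋖ V) :
    Module.finrank F V = Module.finrank F W + 1 := by
  obtain ⟨x, hxV, hxW⟩ := SetLike.exists_of_lt h.lt
  have hsup : W ⊔ Submodule.span F {x} = V := (h.eq_or_eq le_sup_left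
    (sup_le h.le ((Submodule.span_singleton_le_iff_mem x V).2 hxV))).resolve_left fun h' =>
      hxW (h' ▸ (le_sup_right : _ ≤ W ⊔ Submodule.span F {x})
        (Submodule.mem_span_singleton_self x))
  have h1 := Submodule.finrank_sup_add_finrank_inf_eq W (Submodule.span F {x})
  have h2 := finrank_span_singleton (K := F) (v := x) (fun h0 => hxW (h0 ▸ W.zero_mem))
  have h3 := Submodule.finrank_lt_finrank_of_lt h.lt
  rw [hsup] at h1
  omega

/-- A cyclic space of the right nullity inside `V`. -/
theorem exists_isCyclic_le (M : QMatroid F E) (V : Submodule F E) : ∃ X ≤ V, M.IsCyclic X ∧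
    M.rank V + Module.finrank F X = M.rank X + Module.finrank F V := by
  obtain ⟨X, ⟨hXV, hX⟩, hmin⟩ := wellFounded_lt.has_min
    {X : Submodule F E | X ≤ V ∧
      M.rank V + Module.finrank F X = M.rank X + Module.finrank F V} ⟨V, le_rfl, rfl⟩
  refine ⟨X, hXV, M.isCyclic_iff.2 fun W hW => ?_, hX⟩
  -- If the rank dropped on the hyperplane `W`, it would drop by exactly 1, so `W` would have the
  -- same nullity as `X`, against minimality.
  by_contra hne
  refine hmin W ⟨hW.le.trans hXV, ?_⟩ hW.lt
  have h1 := M.rank_mono _ _ hW.le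
  have h2 := M.rank_le_add_of_le (hW.le.trans hXV)
  have h3 := finrank_covBy hW
  omega

/-- A maximal space of the same rank above `X` is flat by maximality, and it inherits cyclicity from
`X`. -/
theorem IsCyclic.exists_mem_cyclicFlats {M : QMatroid F E} {X : Submodule F E}
    (hX : M.IsCyclic X) : ∃ Z ∈ M.cyclicFlats, X ≤ Z ∧ M.rank Z = M.rank X := by
  obtain ⟨Z, ⟨hXZ, hZ⟩, hmax⟩ := wellFounded_gt.has_min
    {Z : Submodule F E | X ≤ Z ∧ M.rank Z = M.rank X} ⟨X, le_rfl, rfl⟩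
  refine ⟨Z, ⟨fun x hx => ?_, M.isCyclic_iff.2 fun W hW => ?_⟩, hXZ, hZ⟩
  · refine (M.rank_mono _ _ le_sup_left).lt_of_ne fun h => ?_
    refine hmax (Z ⊔ Submodule.span F {x}) ⟨hXZ.trans le_sup_left, by rw [← h, hZ]⟩ ?_
    rw [left_lt_sup, Submodule.span_singleton_le_iff_mem]
    exact hx
  · by_cases h : X ≤ W
    · exact le_antisymm (M.rank_mono _ _ hW.le) (hZ ▸ M.rank_mono _ _ h)
    · exact hX.rank_eq_of_covBy hXZ hW h

theorem exists_mem_cyclicFlats (M : QMatroid F E) (V : Submodule F E) : ∃ Z ∈ M.cyclicFlats,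
    M.rank Z + Module.finrank F V ≤
      M.rank V + Module.finrank F (V ⊓ Z : Submodule F E) := by
  obtain ⟨X, hXV, hX, h⟩ := M.exists_isCyclic_le V
  obtain ⟨Z, hZ, hXZ, hr⟩ := hX.exists_mem_cyclicFlats
  refine ⟨Z, hZ, ?_⟩
  have := Submodule.finrank_mono (le_inf hXV hXZ)
  omega

/-! ### Direct sums and the splitting inequality. -/

section DirectSum

variable {E₁ E₂ : Submodule F E} (h : IsCompl E₁ E₂)

theorem exists_rank_directSum (M₁ : QMatroid F E₁) (M₂ : QMatroid F E₂) (V : Submodule F E) :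
    ∃ X ≤ V, (directSum h M₁ M₂).rank V + Module.finrank F X =
      M₁.rank (X.map (E₁.projectionOnto E₂ h)) + M₂.rank (X.map (E₂.projectionOnto E₁ h.symm)) +
        Module.finrank F V := by
  have : Nonempty {X : Submodule F E // X ≤ V} := ⟨⟨⊥, bot_le⟩⟩
  obtain ⟨⟨X, hX : X ≤ V⟩, hXe⟩ := ciInf_mem fun X : {X : Submodule F E // X ≤ V} =>
    ((M₁.comap (E₁.projectionOnto E₂ h)).rank X + (M₂.comap (E₂.projectionOnto E₁ h.symm)).rank X +
      (Module.finrank F V - Module.finrank F (X : Submodule F E)))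
  refine ⟨X, hX, ?_⟩
  have h1 := Submodule.finrank_mono hX
  change _ = (directSum h M₁ M₂).rank V at hXe
  simp only [comap] at hXe
  omega

theorem rank_directSum_le (M₁ : QMatroid F E₁) (M₂ : QMatroid F E₂) {X V : Submodule F E}
    (hX : X ≤ V) : (directSum h M₁ M₂).rank V + Module.finrank F X ≤
      M₁.rank (X.map (E₁.projectionOnto E₂ h)) + M₂.rank (X.map (E₂.projectionOnto E₁ h.symm)) +
        Module.finrank F V := by
  have h1 := Submodule.finrank_mono hX
  have h2 : (directSum h M₁ M₂).rank V ≤ _ := ciInf_le (OrderBot.bddBelow _)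
    (⟨X, hX⟩ : {X : Submodule F E // X ≤ V})
  simp only [comap] at h2
  omega

theorem rank_comap_subtype (M : QMatroid F E) (X : Submodule F E) :
    (M.comap E₁.subtype).rank (X.map (E₁.projectionOnto E₂ h)) =
      M.rank (X.map (E₁.projection E₂ h)) := by
  rw [← map_subtype_map_projectionOnto]
  rfl

theorem comap_subtype_directSum_left (M₁ : QMatroid F E₁) (M₂ : QMatroid F E₂) :
    (directSum h M₁ M₂).comap E₁.subtype = M₁ := by
  have key : ∀ B : Submodule F E₁,
      (B.map E₁.subtype).map (E₁.projectionOnto E₂ h) = B := fun B => by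
    rw [← Submodule.map_comp, Submodule.projectionOnto_comp_subtype, Submodule.map_id]
  have key' : ∀ B : Submodule F E₁,
      (B.map E₁.subtype).map (E₂.projectionOnto E₁ h.symm) = ⊥ := fun B => by
    rw [eq_bot_iff]
    rintro _ ⟨_, ⟨x, -, rfl⟩, rfl⟩
    simp
  ext A
  change (directSum h M₁ M₂).rank (A.map E₁.subtype) = M₁.rank A
  apply le_antisymm
  · have := rank_directSum_le h M₁ M₂ (le_refl (A.map E₁.subtype))
    rw [key, key', rank_bot] at this
    omega
  · obtain ⟨X, hX, he⟩ := exists_rank_directSum h M₁ M₂ (A.map E₁.subtype)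
    obtain ⟨B, hB, rfl⟩ : ∃ B ≤ A, B.map E₁.subtype = X := by
      refine ⟨X.comap E₁.subtype, ?_, ?_⟩
      · have := Submodule.comap_mono (f := E₁.subtype) hX
        rwa [Submodule.comap_map_eq_of_injective E₁.injective_subtype] at this
      · rw [Submodule.map_comap_subtype]
        exact inf_eq_right.2 (hX.trans (Submodule.map_subtype_le E₁ A))
    rw [key, key', rank_bot, Submodule.finrank_map_subtype_eq,
      Submodule.finrank_map_subtype_eq] at he
    have := M₁.rank_le_add_of_le hB
    omega

theorem directSum_comm (M₁ : QMatroid F E₁) (M₂ : QMatroid F E₂) :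
    directSum h.symm M₂ M₁ = directSum h M₁ M₂ := by
  ext V
  simp only [directSum, union, comap]
  simp only [add_comm (M₂.rank _)]

/-- A direct sum is the direct sum of its own restrictions. -/
theorem isReducible_iff (M : QMatroid F E) : M.IsReducible ↔
    ∃ (E₁ E₂ : Submodule F E) (h : IsCompl E₁ E₂), E₁ ≠ ⊥ ∧ E₂ ≠ ⊥ ∧
      ∀ V : Submodule F E, ∃ X ≤ V, M.rank (X.map (E₁.projection E₂ h)) +
        M.rank (X.map (E₂.projection E₁ h.symm)) + Module.finrank F V ≤
          M.rank V + Module.finrank F X := by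
  constructor
  · rintro ⟨E₁, E₂, h, M₁, M₂, h₁, h₂, hM⟩
    refine ⟨E₁, E₂, h, h₁, h₂, fun V => ?_⟩
    have e1 : M.comap E₁.subtype = M₁ := hM ▸ comap_subtype_directSum_left h M₁ M₂
    have e2 : M.comap E₂.subtype = M₂ := by
      rw [hM, ← directSum_comm]
      exact comap_subtype_directSum_left h.symm M₂ M₁
    obtain ⟨X, hX, he⟩ := exists_rank_directSum h M₁ M₂ V
    refine ⟨X, hX, ?_⟩
    rw [← hM, ← e1, ← e2, rank_comap_subtype, rank_comap_subtype] at he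
    exact he.ge
  · rintro ⟨E₁, E₂, h, h₁, h₂, H⟩
    refine ⟨E₁, E₂, h, M.comap E₁.subtype, M.comap E₂.subtype, h₁, h₂, ?_⟩
    ext V
    apply le_antisymm
    -- This inequality needs no assumption on the decomposition: ρ(V) ≤ ρ(X) + dim V - dim X, and
    -- ρ(X) ≤ ρ(π₁X) + ρ(π₂X).
    · obtain ⟨X, hX, he⟩ := exists_rank_directSum h (M.comap E₁.subtype) (M.comap E₂.subtype) V
      rw [rank_comap_subtype, rank_comap_subtype] at he
      have h1 := M.rank_le_add_of_le hX
      have h2 := M.rank_mono _ _ (Submodule.le_map_projection_sup h X)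
      have h3 := M.rank_submodular (X.map (E₁.projection E₂ h)) (X.map (E₂.projection E₁ h.symm))
      omega
    · obtain ⟨X, hX, he⟩ := H V
      have := rank_directSum_le h (M.comap E₁.subtype) (M.comap E₂.subtype) hX
      rw [rank_comap_subtype, rank_comap_subtype] at this
      omega

end DirectSum

/-! ### Sufficient conditions for reducibility. -/

theorem isReducible_of_rank_span_eq_zero (M : QMatroid F E) (hE : 2 ≤ Module.finrank F E) {x : E}
    (hx : x ≠ 0) (hr : M.rank (Submodule.span F {x}) = 0) : M.IsReducible := by
  obtain ⟨W, hW⟩ := exists_isCompl (Submodule.span F {x})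
  refine M.isReducible_iff.2 ⟨_, W, hW, by simpa using hx, ?_, fun V => ⟨V, le_rfl, ?_⟩⟩
  · rintro rfl
    have h1 := Submodule.finrank_add_eq_of_isCompl hW
    rw [finrank_bot, finrank_span_singleton hx] at h1
    omega
  · have h1 := M.rank_mono _ _ (Submodule.map_projection_le hW V)
    have h2 := M.rank_mono _ _ (Submodule.map_projection_le_sup hW.symm V)
    have h3 := M.rank_submodular V (Submodule.span F {x})
    omega

theorem isReducible_of_covBy_top (M : QMatroid F E) (hE : 2 ≤ Module.finrank F E)
    {W : Submodule F E} (hW : W ⋖ ⊤) (hr : M.rank W ≠ M.rank ⊤) : M.IsReducible := by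
  obtain ⟨L, hL⟩ := exists_isCompl W
  have hd := finrank_covBy hW
  have hd' := Submodule.finrank_add_eq_of_isCompl hL
  rw [finrank_top] at hd
  refine M.isReducible_iff.2 ⟨W, L, hL, ?_, ?_, fun V => ?_⟩
  · rintro rfl
    rw [finrank_bot] at hd
    omega
  · rintro rfl
    rw [finrank_bot] at hd'
    omega
  · have h1 := M.rank_mono _ _ hW.le
    -- Inside `W` the projections are trivial; if `V` is not inside `W`, submodularity makes the
    -- rank drop from `V` to `V ⊓ W` as well.
    refine ⟨V ⊓ W, inf_le_left, ?_⟩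
    rw [Submodule.map_projection_of_le_left hL inf_le_right,
      Submodule.map_projection_of_le_right hL.symm inf_le_right, rank_bot]
    by_cases hV : V ≤ W
    · rw [inf_eq_left.2 hV]
      omega
    · have hsup : V ⊔ W = ⊤ := (hW.eq_or_eq le_sup_right le_top).resolve_left
        fun h => hV (h ▸ le_sup_left)
      have h2 := finrank_covBy (inf_covBy_of_covBy_sup_right (hsup.symm ▸ hW : W ⋖ V ⊔ W))
      have h3 := M.rank_submodular V W
      rw [hsup] at h3
      omega

theorem isReducible_of_not_isFull (M : QMatroid F E) (hE : 2 ≤ Module.finrank F E)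
    (h : ¬ M.IsFull) : M.IsReducible := by
  rw [IsFull, not_and_or, closure_bot_eq_bot_iff] at h
  rcases h with h | h
  · push Not at h
    obtain ⟨x, hr, hx⟩ := h
    exact M.isReducible_of_rank_span_eq_zero hE hx hr
  · change ¬ M.IsCyclic ⊤ at h
    rw [isCyclic_iff] at h
    push Not at h
    obtain ⟨W, hW, hr⟩ := h
    exact M.isReducible_of_covBy_top hE hW hr

theorem isReducible_of_cyclicFlats (M : QMatroid F E) {Z₁ Z₂ : Submodule F E} (hZ₁ : Z₁ ≠ ⊥)
    (hZ₂ : Z₂ ≠ ⊥) (h : IsCompl Z₁ Z₂) (hr : M.rank Z₁ + M.rank Z₂ = M.rank ⊤)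
    (hZ : ∀ Y ∈ M.cyclicFlats, ∃ Y₁ ≤ Z₁, ∃ Y₂ ≤ Z₂, Y = Y₁ ⊔ Y₂) : M.IsReducible := by
  refine M.isReducible_iff.2 ⟨Z₁, Z₂, h, hZ₁, hZ₂, fun V => ?_⟩
  obtain ⟨Y, hY, hV⟩ := M.exists_mem_cyclicFlats V
  obtain ⟨Y₁, h₁, Y₂, h₂, rfl⟩ := hZ Y hY
  -- The projections of this space lie in `Y₁` and `Y₂`, whose ranks add up to that of the cyclic
  -- flat.
  refine ⟨V ⊓ (Y₁ ⊔ Y₂), inf_le_left, ?_⟩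
  have a1 := M.rank_sup_of_isCompl h hr h₁ h₂
  have a2 := M.rank_mono _ _ (Submodule.map_mono (f := Z₁.projection Z₂ h)
    (inf_le_right : V ⊓ (Y₁ ⊔ Y₂) ≤ _))
  have a3 := M.rank_mono _ _ (Submodule.map_mono (f := Z₂.projection Z₁ h.symm)
    (inf_le_right : V ⊓ (Y₁ ⊔ Y₂) ≤ _))
  rw [Submodule.map_projection_sup_of_le h h₁ h₂] at a2
  rw [sup_comm, Submodule.map_projection_sup_of_le h.symm h₂ h₁, sup_comm] at a3
  omega

/-! ### Cyclic flats of a split `q`-matroid. -/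

section Splitting

variable {M : QMatroid F E} {E₁ E₂ : Submodule F E} {h : IsCompl E₁ E₂}

theorem rank_top_of_splitting
    (H : ∀ V : Submodule F E, ∃ X ≤ V, M.rank (X.map (E₁.projection E₂ h)) +
      M.rank (X.map (E₂.projection E₁ h.symm)) + Module.finrank F V ≤
        M.rank V + Module.finrank F X) : M.rank E₁ + M.rank E₂ = M.rank ⊤ := by
  obtain ⟨X, -, hX⟩ := H ⊤
  have a1 := M.rank_le_add_of_le (Submodule.map_projection_le h X)
  have a2 := M.rank_le_add_of_le (Submodule.map_projection_le h.symm X)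
  have a3 := Submodule.finrank_mono (Submodule.le_map_projection_sup h X)
  have a4 := Submodule.finrank_add_le_finrank_add_finrank (X.map (E₁.projection E₂ h))
    (X.map (E₂.projection E₁ h.symm))
  have a5 := Submodule.finrank_add_eq_of_isCompl h
  have a6 := M.rank_submodular E₁ E₂
  rw [h.sup_eq_top] at a6
  rw [finrank_top] at hX
  omega

theorem eq_sup_of_mem_cyclicFlats
    (H : ∀ V : Submodule F E, ∃ X ≤ V, M.rank (X.map (E₁.projection E₂ h)) +
      M.rank (X.map (E₂.projection E₁ h.symm)) + Module.finrank F V ≤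
        M.rank V + Module.finrank F X) {V : Submodule F E} (hV : V ∈ M.cyclicFlats) :
    V = V.map (E₁.projection E₂ h) ⊔ V.map (E₂.projection E₁ h.symm) := by
  obtain ⟨X, hXV, hX⟩ := H V
  have a1 := M.rank_mono _ _ (Submodule.le_map_projection_sup h X)
  have a2 := M.rank_submodular (X.map (E₁.projection E₂ h)) (X.map (E₂.projection E₁ h.symm))
  obtain rfl | hlt := hXV.eq_or_lt
  -- When X = V, the sum of the projections has rank at most ρ(V), so flatness forbids it to be
  -- larger than `V`.
  · refine (Submodule.le_map_projection_sup h X).eq_or_lt.resolve_right fun hlt => ?_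
    have := hV.1.rank_lt hlt
    omega
  · obtain ⟨W, hXW, hW⟩ := exists_le_covBy_of_lt hlt
    -- A proper `X` lies in a hyperplane of full rank; this costs one dimension and contradicts the
    -- inequality for `X`.
    have a3 := M.isCyclic_iff.1 hV.2 W hW
    have a4 := M.rank_le_add_of_le hXW
    have a5 := finrank_covBy hW
    omega

end Splitting

theorem left_mem_cyclicFlats {M : QMatroid F E} {E₁ E₂ Y₁ Y₂ : Submodule F E}
    (h : IsCompl E₁ E₂) (hr : M.rank E₁ + M.rank E₂ = M.rank ⊤)
    (h0 : ∀ x, M.rank (Submodule.span F {x}) = 0 → x = 0) (h₁ : Y₁ ≤ E₁) (h₂ : Y₂ ≤ E₂)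
    (hY : Y₁ ⊔ Y₂ ∈ M.cyclicFlats) : Y₁ ∈ M.cyclicFlats := by
  have hY12 := M.rank_sup_of_isCompl h hr h₁ h₂
  refine ⟨fun x hx => ?_, M.isCyclic_iff.2 fun W hW => ?_⟩
  · by_contra hlt
    have hxY : x ∈ Y₁ ⊔ Y₂ := by
      by_contra hxY
      have b1 := hY.1 x hxY
      have b2 := M.rank_submodular (Y₁ ⊔ Y₂) (Y₁ ⊔ Submodule.span F {x})
      have b3 := M.rank_mono _ _ (le_inf le_sup_left le_sup_left :
        Y₁ ≤ (Y₁ ⊔ Y₂) ⊓ (Y₁ ⊔ Submodule.span F {x}))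
      have b4 := M.rank_mono _ _ (sup_le_sup_left le_sup_right _ :
        (Y₁ ⊔ Y₂) ⊔ Submodule.span F {x} ≤ (Y₁ ⊔ Y₂) ⊔ (Y₁ ⊔ Submodule.span F {x}))
      omega
    -- Now `y₂` lies in a space of the rank of `Y₁`, so additivity gives it rank 0, and then `h0`
    -- gives y₂ = 0.
    obtain ⟨y₁, hy₁, y₂, hy₂, rfl⟩ := Submodule.mem_sup.1 hxY
    have hle : Submodule.span F {y₂} ≤ Y₁ ⊔ Submodule.span F {y₁ + y₂} := by
      rw [Submodule.span_singleton_le_iff_mem]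
      have := sub_mem (Submodule.mem_sup_right (Submodule.mem_span_singleton_self (y₁ + y₂)))
        (Submodule.mem_sup_left hy₁ : y₁ ∈ Y₁ ⊔ Submodule.span F {y₁ + y₂})
      rwa [add_sub_cancel_left] at this
    have c1 := M.rank_sup_of_isCompl h hr h₁
      ((Submodule.span_singleton_le_iff_mem y₂ E₂).2 (h₂ hy₂))
    have c2 := M.rank_mono _ _ (sup_le le_sup_left hle)
    have c3 := h0 y₂ (by omega)
    rw [c3, add_zero] at hx
    exact hx hy₁
  · have hWY := M.rank_sup_of_isCompl h hr (hW.le.trans h₁) h₂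
    have hlt : W ⊔ Y₂ < Y₁ ⊔ Y₂ := by
      refine (sup_le_sup_right hW.le _).lt_of_ne fun he => hW.lt.ne ?_
      rw [← Submodule.map_projection_sup_of_le h (hW.le.trans h₁) h₂, he,
        Submodule.map_projection_sup_of_le h h₁ h₂]
    -- By dimension `U` is `W ⊔ Y₂` itself, so cyclicity of the sum applies and `Y₂` cancels by
    -- additivity.
    obtain ⟨U, hU, hUY⟩ := exists_le_covBy_of_lt hlt
    have hd := Submodule.finrank_sup_add_finrank_inf_eq W Y₂
    have hd' := Submodule.finrank_sup_add_finrank_inf_eq Y₁ Y₂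
    rw [((h.disjoint.mono_left h₁).mono_right h₂).eq_bot, finrank_bot] at hd'
    rw [((h.disjoint.mono_left (hW.le.trans h₁)).mono_right h₂).eq_bot, finrank_bot] at hd
    have hU' : W ⊔ Y₂ = U := by
      refine Submodule.eq_of_le_of_finrank_le hU ?_
      have e1 := finrank_covBy hW
      have e2 := finrank_covBy hUY
      omega
    have e3 := M.isCyclic_iff.1 hY.2 U hUY
    rw [← hU'] at e3
    omega

theorem sup_mem_cyclicFlats {M : QMatroid F E} {E₁ E₂ Y₁ Y₂ : Submodule F E}
    {h : IsCompl E₁ E₂}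
    (H : ∀ V : Submodule F E, ∃ X ≤ V, M.rank (X.map (E₁.projection E₂ h)) +
      M.rank (X.map (E₂.projection E₁ h.symm)) + Module.finrank F V ≤
        M.rank V + Module.finrank F X)
    (h₁ : Y₁ ≤ E₁) (h₂ : Y₂ ≤ E₂) (hY₁ : Y₁ ∈ M.cyclicFlats) (hY₂ : Y₂ ∈ M.cyclicFlats) :
    Y₁ ⊔ Y₂ ∈ M.cyclicFlats := by
  refine ⟨fun x hx => ?_, hY₁.2.sup hY₂.2⟩
  have hr := rank_top_of_splitting H
  have hcov : Y₁ ⊔ Y₂ ⋖ (Y₁ ⊔ Y₂) ⊔ Submodule.span F {x} := by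
    rw [sup_comm (Y₁ ⊔ Y₂)]
    exact Submodule.covBy_span_singleton_sup hx
  have hd := finrank_covBy hcov
  obtain ⟨X, hXV, hX⟩ := H ((Y₁ ⊔ Y₂) ⊔ Submodule.span F {x})
  have a1 := M.rank_submodular (X.map (E₁.projection E₂ h)) Y₁
  have a2 := M.rank_submodular (X.map (E₂.projection E₁ h.symm)) Y₂
  have a3 := M.rank_sup_of_isCompl h hr h₁ h₂
  have a4 : M.rank (X ⊓ (Y₁ ⊔ Y₂)) ≤ M.rank (X.map (E₁.projection E₂ h) ⊓ Y₁) +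
      M.rank (X.map (E₂.projection E₁ h.symm) ⊓ Y₂) := by
    rw [← M.rank_sup_of_isCompl h hr (inf_le_right.trans h₁) (inf_le_right.trans h₂)]
    refine M.rank_mono _ _ ((Submodule.le_map_projection_sup h _).trans (sup_le_sup
      (le_inf (Submodule.map_mono inf_le_left) ?_) (le_inf (Submodule.map_mono inf_le_left) ?_)))
    · exact (Submodule.map_mono inf_le_right).trans
        (Submodule.map_projection_sup_of_le h h₁ h₂).le
    · rw [sup_comm]
      exact (Submodule.map_mono inf_le_right).trans
        (Submodule.map_projection_sup_of_le h.symm h₂ h₁).le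
  have a5 := M.rank_le_add_of_le (inf_le_right : X ⊓ (Y₁ ⊔ Y₂) ≤ Y₁ ⊔ Y₂)
  by_cases hXY : X ≤ Y₁ ⊔ Y₂
  · rw [inf_eq_left.2 hXY] at a4 a5
    have b1 := M.rank_mono _ _ (inf_le_left : X.map (E₁.projection E₂ h) ⊓ Y₁ ≤ _)
    have b2 := M.rank_mono _ _ (inf_le_left : X.map (E₂.projection E₁ h.symm) ⊓ Y₂ ≤ _)
    omega
  · have hsup : X ⊔ (Y₁ ⊔ Y₂) = (Y₁ ⊔ Y₂) ⊔ Submodule.span F {x} :=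
      (hcov.eq_or_eq le_sup_right (sup_le hXV le_sup_left)).resolve_left
        fun he => hXY (he ▸ le_sup_left)
    have hd' := Submodule.finrank_sup_add_finrank_inf_eq X (Y₁ ⊔ Y₂)
    rw [hsup] at hd'
    have c1 := M.rank_mono _ _ (le_sup_right : Y₁ ≤ X.map (E₁.projection E₂ h) ⊔ Y₁)
    have c2 := M.rank_mono _ _ (le_sup_right : Y₂ ≤ X.map (E₂.projection E₁ h.symm) ⊔ Y₂)
    -- The inequalities combine to ρ(Y₁ + Y₂) + Σ (ρ(πᵢX + Yᵢ) - ρ(Yᵢ)) ≤ ρ(Y₁ + Y₂ + ⟨x⟩). Some πᵢX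
    -- is not inside Yᵢ, so flatness of that Yᵢ makes the sum positive.
    by_cases hX₁ : X.map (E₁.projection E₂ h) ≤ Y₁
    · have hX₂ : ¬ X.map (E₂.projection E₁ h.symm) ≤ Y₂ := fun hX₂ =>
        hXY ((Submodule.le_map_projection_sup h X).trans (sup_le_sup hX₁ hX₂))
      have := hY₂.1.rank_lt (right_lt_sup.2 hX₂)
      omega
    · have := hY₁.1.rank_lt (right_lt_sup.2 hX₁)
      omega

theorem IsReducible.exists_cyclicFlats {M : QMatroid F E} (hM : M.IsReducible)
    (hfull : M.IsFull) : ∃ Z₁ ∈ M.cyclicFlats, ∃ Z₂ ∈ M.cyclicFlats,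
      Z₁ ≠ ⊥ ∧ Z₂ ≠ ⊥ ∧ IsCompl Z₁ Z₂ ∧ M.rank Z₁ + M.rank Z₂ = M.rank ⊤ ∧
      {Y : Submodule F E | ∃ Y₁ ∈ M.cyclicFlats, ∃ Y₂ ∈ M.cyclicFlats,
        Y₁ ≤ Z₁ ∧ Y₂ ≤ Z₂ ∧ Y = Y₁ ⊔ Y₂} = M.cyclicFlats := by
  obtain ⟨E₁, E₂, h, hE₁, hE₂, H⟩ := M.isReducible_iff.1 hM
  have h0 := M.closure_bot_eq_bot_iff.1 hfull.1
  have hr := rank_top_of_splitting H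
  have hr' : M.rank E₂ + M.rank E₁ = M.rank ⊤ := by rw [add_comm, hr]
  have key : ∀ {Y₁ Y₂ : Submodule F E}, Y₁ ≤ E₁ → Y₂ ≤ E₂ → Y₁ ⊔ Y₂ ∈ M.cyclicFlats →
      Y₁ ∈ M.cyclicFlats ∧ Y₂ ∈ M.cyclicFlats := fun {Y₁ Y₂} h₁ h₂ hY =>
    ⟨left_mem_cyclicFlats h hr h0 h₁ h₂ hY,
      left_mem_cyclicFlats h.symm hr' h0 h₂ h₁ (sup_comm Y₁ Y₂ ▸ hY)⟩
  obtain ⟨hZ₁, hZ₂⟩ := key le_rfl le_rfl (h.sup_eq_top.symm ▸ hfull.top_mem_cyclicFlats)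
  refine ⟨E₁, hZ₁, E₂, hZ₂, hE₁, hE₂, h, hr, Set.ext fun Y => ⟨?_, fun hY => ?_⟩⟩
  · rintro ⟨Y₁, hY₁, Y₂, hY₂, h₁, h₂, rfl⟩
    exact sup_mem_cyclicFlats H h₁ h₂ hY₁ hY₂
  · have he := eq_sup_of_mem_cyclicFlats H hY
    have h₁ := Submodule.map_projection_le h Y
    have h₂ := Submodule.map_projection_le h.symm Y
    obtain ⟨hY₁, hY₂⟩ := key h₁ h₂ (he ▸ hY)
    exact ⟨_, hY₁, _, hY₂, h₁, h₂, he⟩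

end QMatroid

theorem mainTheorem3 {F E : Type*} [Field F] [Finite F] [AddCommGroup E] [Module F E]
    [FiniteDimensional F E] (M : QMatroid F E) (hE : 2 ≤ Module.finrank F E) :
    M.IsIrreducible ↔
      (M.IsFull ∧
        ¬ ∃ Z₁ ∈ M.cyclicFlats, ∃ Z₂ ∈ M.cyclicFlats,
          Z₁ ≠ ⊥ ∧ Z₂ ≠ ⊥ ∧
          IsCompl Z₁ Z₂ ∧
          M.rank Z₁ + M.rank Z₂ = M.rank ⊤ ∧
          {Y : Submodule F E | ∃ Y₁ ∈ M.cyclicFlats, ∃ Y₂ ∈ M.cyclicFlats,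
            Y₁ ≤ Z₁ ∧ Y₂ ≤ Z₂ ∧ Y = Y₁ ⊔ Y₂} = M.cyclicFlats) := by
  constructor
  · intro hM
    have hfull : M.IsFull := by
      by_contra hfull
      exact hM (M.isReducible_of_not_isFull hE hfull)
    refine ⟨hfull, ?_⟩
    rintro ⟨Z₁, -, Z₂, -, hZ₁, hZ₂, h, hr, hZ⟩
    refine hM (M.isReducible_of_cyclicFlats hZ₁ hZ₂ h hr fun Y hY => ?_)
    rw [← hZ] at hY
    obtain ⟨Y₁, -, Y₂, -, h₁, h₂, he⟩ := hY
    exact ⟨Y₁, h₁, Y₂, h₂, he⟩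
  · rintro ⟨hfull, hne⟩ hM
    exact hne (hM.exists_cyclicFlats hfull)
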